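/- Let $p\ge 2$ and $q$ be fixed, let $\boldsymbol\mu\in\mathbb R^p$ and $\boldsymbol\alpha\in\mathbb R^q$ be fixed, and let $\boldsymbol\Sigma$ be a fixed $p\times p$ positive-definite matrix with ordered eigenvalues $\lambda_1>\lambda_2\ge\cdots\ge\lambda_p>0$ and unit eigenvector $\boldsymbol\gamma_1$ for $\lambda_1$. For each $n$, let $\boldsymbol X$ be a nonrandom real $n\times q$ matrix with $\boldsymbol X'\boldsymbol 1_n=\boldsymbol 0$, and consider the multivariate allometric regression model $$\boldsymbol Y=\boldsymbol 1_n\boldsymbol\mu'+\boldsymbol X\boldsymbol\alpha\boldsymbol\gamma_1'+\boldsymbol E,\qquad \mathrm{vec}(\boldsymbol E)\sim\mathcal N_{np}(\boldsymbol 0,\boldsymbol\Sigma\otimes\boldsymbol I_n).$$ Put $$\boldsymbol S_R=\boldsymbol Y'\boldsymbol X(\boldsymbol X'\boldsymbol X)^{-1}\boldsymbol X'\boldsymbol Y,\qquad \boldsymbol S_E=\boldsymbol Y'\{\boldsymbol I_n-\tfrac1n\boldsymbol 1_n\boldsymbol 1_n'-\boldsymbol X(\boldsymbol X'\boldsymbol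 X)^{-1}\boldsymbol X'\}\boldsymbol Y,\qquad \boldsymbol S(w)=(1-w)\boldsymbol S_R+w\boldsymbol S_E,$$ and let $\hat{\boldsymbol\gamma}_1(w)$ be a first principal eigenvector of $\boldsymbol S(w)$, that is, a unit eigenvector for its largest eigenvalue. Let $\hat{\boldsymbol\Sigma}=\boldsymbol S_E/(n-1-q)$, with largest and second largest eigenvalues $\hat\lambda_1,\hat\lambda_2$, and $$\widehat{\mathrm{tr}(\boldsymbol\Sigma^2)}=\frac{1}{(n+1-q)(n-2-q)}\Big\{\mathrm{tr}(\boldsymbol S_E^2)-\frac{(\mathrm{tr}\,\boldsymbol S_E)^2}{n-1-q}\Big\},$$ $$\hat a=\widehat{\mathrm{tr}(\boldsymbol\Sigma^2)}+(\mathrm{tr}\,\hat{\boldsymbol\Sigma})^2,\quad \hat b=\hat\lambda_1+\mathrm{tr}\,\hat{\boldsymbol\Sigma},\quad \hat c=\mathrm{tr}\,\boldsymbol S_R-q\,\mathrm{tr}\,\hat{\boldsymbol\Sigma},\quad \hat d=\hat\lambda_1-\hat\lambda_2,$$ $$\hat w^*=\frac{\hat a\hat d q+2\hat b\hat c\hat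 d}{2\hat a\hat d q+2\hat b\hat c\hat d+\hat a\hat c}.$$ (These quantities are well defined with probability tending to $1$ as $n\to\infty$ under the assumptions below; how they are defined otherwise is immaterial.) Suppose that $\boldsymbol\alpha\ne\boldsymbol 0$ and that $n^{-1}\boldsymbol X'\boldsymbol X$ converges to a positive-definite matrix as $n\to\infty$. Then the feasible estimator $\hat{\boldsymbol\gamma}_1(\hat w^*)$ is consistent up to sign: as $n\to\infty$, $$\min_{\theta=-1,1}\|\theta\,\hat{\boldsymbol\gamma}_1(\hat w^*)-\boldsymbol\gamma_1\|\to 0\quad\text{in probability}.$$ -/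

import Mathlib

open Matrix MeasureTheory ProbabilityTheory Filter Topology
open scoped Kronecker ENNReal

namespace AllometricRegression

/-- The `k`-th eigenvalue (counted from `0`, with multiplicity, in non-increasing order) of a
real symmetric `p × p` matrix. -/
noncomputable def orderedEigenvalue {p : ℕ} {A : Matrix (Fin p) (Fin p) ℝ}
    (hA : A.IsHermitian) (k : Fin p) : ℝ :=
  hA.eigenvalues₀ (Fin.cast (Fintype.card_fin p).symm k)

/-- The largest eigenvalue. -/
noncomputable def eig1 {p : ℕ} (hp : 2 ≤ p) {A : Matrix (Fin p) (Fin p) ℝ}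
    (hA : A.IsHermitian) : ℝ :=
  orderedEigenvalue hA ⟨0, by omega⟩

/-- The second largest eigenvalue, counted with multiplicity. -/
noncomputable def eig2 {p : ℕ} (hp : 2 ≤ p) {A : Matrix (Fin p) (Fin p) ℝ}
    (hA : A.IsHermitian) : ℝ :=
  orderedEigenvalue hA ⟨1, by omega⟩

/-- `v` is a first principal eigenvector of the symmetric matrix `A`: a vector of Euclidean norm
one that is an eigenvector for the largest eigenvalue of `A`. -/
def IsFirstPrincipalEigenvector {p : ℕ} (hp : 2 ≤ p) {A : Matrix (Fin p) (Fin p) ℝ}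
    (hA : A.IsHermitian) (v : EuclideanSpace ℝ (Fin p)) : Prop :=
  ‖v‖ = 1 ∧ A *ᵥ v.ofLp = eig1 hp hA • v.ofLp

variable {n p q : ℕ}

/-- The response matrix `Y = 1ₙ μ' + X α γ₁' + E` of the multivariate allometric regression
model. -/
def response (μ : Fin p → ℝ) (α : Fin q → ℝ) (γ₁ : EuclideanSpace ℝ (Fin p))
    (X : Matrix (Fin n) (Fin q) ℝ) (E : Matrix (Fin n) (Fin p) ℝ) :
    Matrix (Fin n) (Fin p) ℝ :=
  vecMulVec (fun _ => 1) μ + X * vecMulVec α γ₁.ofLp + E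

/-- The matrix `X (X'X)⁻¹ X'`. -/
noncomputable def hatMatrix (X : Matrix (Fin n) (Fin q) ℝ) : Matrix (Fin n) (Fin n) ℝ :=
  X * (Xᵀ * X)⁻¹ * Xᵀ

/-- The regression sum-of-squares matrix. -/
noncomputable def SR (X : Matrix (Fin n) (Fin q) ℝ) (Y : Matrix (Fin n) (Fin p) ℝ) :
    Matrix (Fin p) (Fin p) ℝ :=
  Yᵀ * hatMatrix X * Y

/-- The residual sum-of-squares matrix. -/
noncomputable def SE (X : Matrix (Fin n) (Fin q) ℝ) (Y : Matrix (Fin n) (Fin p) ℝ) :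
    Matrix (Fin p) (Fin p) ℝ :=
  Yᵀ * (1 - (1 / (n : ℝ)) • vecMulVec (fun _ => 1) (fun _ => 1) - hatMatrix X) * Y

/-- The weighted matrix `S(w) = (1 - w) S_R + w S_E`. -/
noncomputable def S (w : ℝ) (X : Matrix (Fin n) (Fin q) ℝ) (Y : Matrix (Fin n) (Fin p) ℝ) :
    Matrix (Fin p) (Fin p) ℝ :=
  (1 - w) • SR X Y + w • SE X Y

/-- The covariance estimator `S_E / (n - 1 - q)`. -/
noncomputable def sigmaHat (X : Matrix (Fin n) (Fin q) ℝ) (Y : Matrix (Fin n) (Fin p) ℝ) :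
    Matrix (Fin p) (Fin p) ℝ :=
  (1 / ((n : ℝ) - 1 - q)) • SE X Y

theorem hatMatrix_transpose (X : Matrix (Fin n) (Fin q) ℝ) :
    (hatMatrix X)ᵀ = hatMatrix X := by
  simp [hatMatrix, Matrix.transpose_mul, Matrix.transpose_nonsing_inv, Matrix.mul_assoc]

theorem SR_isHermitian (X : Matrix (Fin n) (Fin q) ℝ) (Y : Matrix (Fin n) (Fin p) ℝ) :
    (SR X Y).IsHermitian := by
  rw [Matrix.IsHermitian, Matrix.conjTranspose_eq_transpose_of_trivial]
  simp [SR, Matrix.transpose_mul, hatMatrix_transpose, Matrix.mul_assoc]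

theorem SE_isHermitian (X : Matrix (Fin n) (Fin q) ℝ) (Y : Matrix (Fin n) (Fin p) ℝ) :
    (SE X Y).IsHermitian := by
  rw [Matrix.IsHermitian, Matrix.conjTranspose_eq_transpose_of_trivial]
  simp [SE, Matrix.transpose_mul, hatMatrix_transpose, Matrix.mul_assoc,
    Matrix.transpose_vecMulVec]

theorem S_isHermitian (w : ℝ) (X : Matrix (Fin n) (Fin q) ℝ) (Y : Matrix (Fin n) (Fin p) ℝ) :
    (S w X Y).IsHermitian :=
  ((SR_isHermitian X Y).smul (IsSelfAdjoint.all _)).add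
    ((SE_isHermitian X Y).smul (IsSelfAdjoint.all _))

theorem sigmaHat_isHermitian (X : Matrix (Fin n) (Fin q) ℝ) (Y : Matrix (Fin n) (Fin p) ℝ) :
    (sigmaHat X Y).IsHermitian :=
  (SE_isHermitian X Y).smul (IsSelfAdjoint.all _)

/-- The estimator of `tr (Σ²)`. -/
noncomputable def trSqHat (X : Matrix (Fin n) (Fin q) ℝ) (Y : Matrix (Fin n) (Fin p) ℝ) : ℝ :=
  1 / (((n : ℝ) + 1 - q) * ((n : ℝ) - 2 - q)) *
    ((SE X Y ^ 2).trace - (SE X Y).trace ^ 2 / ((n : ℝ) - 1 - q))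

noncomputable def aHat (X : Matrix (Fin n) (Fin q) ℝ) (Y : Matrix (Fin n) (Fin p) ℝ) : ℝ :=
  trSqHat X Y + (sigmaHat X Y).trace ^ 2

noncomputable def bHat (hp : 2 ≤ p) (X : Matrix (Fin n) (Fin q) ℝ)
    (Y : Matrix (Fin n) (Fin p) ℝ) : ℝ :=
  eig1 hp (sigmaHat_isHermitian X Y) + (sigmaHat X Y).trace

noncomputable def cHat (X : Matrix (Fin n) (Fin q) ℝ) (Y : Matrix (Fin n) (Fin p) ℝ) : ℝ :=
  (SR X Y).trace - q * (sigmaHat X Y).trace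

noncomputable def dHat (hp : 2 ≤ p) (X : Matrix (Fin n) (Fin q) ℝ)
    (Y : Matrix (Fin n) (Fin p) ℝ) : ℝ :=
  eig1 hp (sigmaHat_isHermitian X Y) - eig2 hp (sigmaHat_isHermitian X Y)

/-- The data-driven weight `ŵ*`. -/
noncomputable def wHat (hp : 2 ≤ p) (X : Matrix (Fin n) (Fin q) ℝ)
    (Y : Matrix (Fin n) (Fin p) ℝ) : ℝ :=
  (aHat X Y * dHat hp X Y * q + 2 * bHat hp X Y * cHat X Y * dHat hp X Y) /
    (2 * aHat X Y * dHat hp X Y * q + 2 * bHat hp X Y * cHat X Y * dHat hp X Y +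
      aHat X Y * cHat X Y)

/-- `g` is (a realization of) the feasible estimator `γ̂₁(ŵ*)`: a first principal eigenvector of
`S(ŵ*)`. -/
def IsFeasibleEstimate (hp : 2 ≤ p) (X : Matrix (Fin n) (Fin q) ℝ)
    (Y : Matrix (Fin n) (Fin p) ℝ) (g : EuclideanSpace ℝ (Fin p)) : Prop :=
  IsFirstPrincipalEigenvector hp (S_isHermitian (wHat hp X Y) X Y) g

/-- The estimation error up to sign, `min_{θ = -1, 1} ‖θ g - γ₁‖`. -/
noncomputable def signError (g γ₁ : EuclideanSpace ℝ (Fin p)) : ℝ :=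
  min ‖(-1 : ℝ) • g - γ₁‖ ‖(1 : ℝ) • g - γ₁‖

/-- Convergence in probability to `0` of random variables `Z n`, each on its own probability
space. -/
def TendstoZeroInProbability {Ω : ℕ → Type*} [∀ n, MeasurableSpace (Ω n)]
    (P : ∀ n, Measure (Ω n)) (Z : ∀ n, Ω n → ℝ) : Prop :=
  ∀ ε : ℝ, 0 < ε → Tendsto (fun n => P n {ω | ε ≤ |Z n ω|}) atTop (𝓝 0)

/-- The `n × p` random matrix `E` is a normal error matrix:
`vec E ~ N_{np}(0, Σ ⊗ Iₙ)`, where `vec` stacks the columns. -/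
def IsNormalError {Ω : Type*} [MeasurableSpace Ω] (Sig : Matrix (Fin p) (Fin p) ℝ)
    (E : Ω → Matrix (Fin n) (Fin p) ℝ) (P : Measure Ω) : Prop :=
  HasLaw (fun ω => WithLp.toLp 2 (vec (E ω)))
    (multivariateGaussian (0 : EuclideanSpace ℝ (Fin p × Fin n))
      (Sig ⊗ₖ (1 : Matrix (Fin n) (Fin n) ℝ))) P

end AllometricRegression

/-!
The proof turns convergence in probability into convergence along a filter and then argues
deterministically.

Sets of pairs `(n, ω)` whose sections have probability tending to one form a filter,
`highProbability P`, and convergence in probability is convergence along it. So limits in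
probability may be combined by continuity and mixed with deterministic limits in `n`. Chebyshev's
inequality and the independence of the rows of `E` give `X'E / n → 0`, `1'E / n → 0` and
`E'E / n → Σ` (`tendsto_weighted_mean_error`, `tendsto_second_moment_error`). The two sums of
squares are continuous functions of these averages and of `X'X / n → M`, whence
`S_R / n → δ γ₁ γ₁'` with `δ = α'Mα > 0` (`tendsto_inv_smul_SR_response`) and `S_E / n → Σ`
(`tendsto_inv_smul_SE_response`).

The limit of the weight is not needed. As soon as the estimated quantities `â`, `b̂`, `ĉ`, `d̂` are
nonnegative, `ŵ*` lies in `[0, 1]` (`eventually_wHat_mem_Icc`): `â ≥ 0` holds for every sample of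
size at least `q + 3`, `d̂ ≥ 0` always, and `b̂`, `ĉ` are positive with probability tending to one.
For any weight in `[0, 1]` the matrix `(1 - w) δ γ₁ γ₁' + w Σ` has `γ₁` as principal eigenvector
with a spectral gap of at least `min δ (λ₁ - λ₂)`. Comparing the quadratic forms of `S(ŵ*) / n` at
`γ₁` and at the maximizer `γ̂₁` therefore bounds `1 - (γ₁'γ̂₁)²`, uniformly in the weight, by the
errors of `S_R / n` and `S_E / n` (`gap_mul_le_of_convexCombination`); the squared sign error is at
most twice this quantity (`signError_sq_le`).
-/

namespace AllometricRegression

/-! ### Convergence in probability along a filter -/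

/-- The filter on `Σ n, Ω n` of the sets whose sections have probability tending to one.
Convergence in probability to a constant is convergence along this filter, and properties that
hold with probability tending to one are those that hold eventually. The sections need not be
measurable: `P n` acts as an outer measure. -/
def highProbability {Ω : ℕ → Type*} [∀ n, MeasurableSpace (Ω n)] (P : ∀ n, Measure (Ω n)) :
    Filter (Σ n, Ω n) where
  sets := {A | Tendsto (fun n => P n {ω | (⟨n, ω⟩ : Σ n, Ω n) ∉ A}) atTop (𝓝 0)}
  univ_sets := by simp
  sets_of_superset := by
    intro A B hA hAB
    refine tendsto_of_tendsto_of_tendsto_of_le_of_le tendsto_const_nhds hA (fun _ => zero_le) ?_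
    exact fun n => measure_mono fun ω hω hA' => hω (hAB hA')
  inter_sets := by
    intro A B hA hB
    have h := Tendsto.add (Set.mem_ofPred_eq ▸ hA) (Set.mem_ofPred_eq ▸ hB)
    rw [add_zero] at h
    refine tendsto_of_tendsto_of_tendsto_of_le_of_le tendsto_const_nhds h (fun _ => zero_le) ?_
    refine fun n => le_trans (measure_mono ?_) (measure_union_le _ _)
    intro ω hω
    by_cases h1 : (⟨n, ω⟩ : Σ n, Ω n) ∈ A
    · exact Or.inr fun h2 => hω ⟨h1, h2⟩
    · exact Or.inl h1

section HighProbability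

variable {Ω : ℕ → Type*} [∀ n, MeasurableSpace (Ω n)] {P : ∀ n, Measure (Ω n)}

theorem mem_highProbability {A : Set (Σ n, Ω n)} :
    A ∈ highProbability P ↔
      Tendsto (fun n => P n {ω | (⟨n, ω⟩ : Σ n, Ω n) ∉ A}) atTop (𝓝 0) := Iff.rfl

theorem tendsto_fst_highProbability :
    Tendsto (Sigma.fst : (Σ n, Ω n) → ℕ) (highProbability P) atTop := by
  rw [tendsto_atTop]
  intro N
  rw [Filter.Eventually, mem_highProbability]
  refine tendsto_const_nhds.congr' ?_
  filter_upwards [eventually_ge_atTop N] with n hn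
  simp [hn]

theorem tendstoZeroInProbability_of_tendsto {Z : ∀ n, Ω n → ℝ}
    (h : Tendsto (fun x : Σ n, Ω n => Z x.1 x.2) (highProbability P) (𝓝 0)) :
    TendstoZeroInProbability P Z := by
  intro ε hε
  have h1 := h.eventually (Metric.ball_mem_nhds (0 : ℝ) hε)
  rw [Filter.Eventually, mem_highProbability] at h1
  simpa using h1

/-- Chebyshev's inequality: square-integrable variables with common mean and vanishing variance
converge in probability to the mean. -/
theorem tendsto_highProbability_of_variance [∀ n, IsProbabilityMeasure (P n)]
    {Z : ∀ n, Ω n → ℝ} {m : ℝ} (hZ : ∀ n, MemLp (Z n) 2 (P n))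
    (hm : ∀ᶠ n in atTop, ∫ ω, Z n ω ∂(P n) = m)
    (hv : Tendsto (fun n => Var[Z n; P n]) atTop (𝓝 0)) :
    Tendsto (fun x : Σ n, Ω n => Z x.1 x.2) (highProbability P) (𝓝 m) := by
  rw [Metric.tendsto_nhds]
  intro ε hε
  rw [Filter.Eventually, mem_highProbability]
  have h1 : Tendsto (fun n => ENNReal.ofReal (Var[Z n; P n] / ε ^ 2)) atTop (𝓝 0) := by
    simpa using ENNReal.tendsto_ofReal (hv.div_const (ε ^ 2))
  refine tendsto_of_tendsto_of_tendsto_of_le_of_le' tendsto_const_nhds h1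
    (Eventually.of_forall fun _ => zero_le) ?_
  filter_upwards [hm] with n hn
  have := meas_ge_le_variance_div_sq (hZ n) hε
  rw [hn] at this
  simpa [Real.dist_eq] using this

end HighProbability

/-! ### Normal error matrices -/

section NormalError

variable {n p : ℕ} {Ω : Type*} [MeasurableSpace Ω] {P : Measure Ω}
  {Sig : Matrix (Fin p) (Fin p) ℝ} {E : Ω → Matrix (Fin n) (Fin p) ℝ}

theorem posSemidef_kronecker_one (hSig : Sig.PosSemidef) :
    (Sig ⊗ₖ (1 : Matrix (Fin n) (Fin n) ℝ)).PosSemidef :=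
  hSig.kronecker PosSemidef.one

theorem IsNormalError.hasLaw_entry (hSig : Sig.PosSemidef) (hE : IsNormalError Sig E P)
    (i : Fin n) (a : Fin p) :
    HasLaw (fun ω => E ω i a) (gaussianReal 0 (Sig a a).toNNReal) P := by
  have h := (measurePreserving_eval_multivariateGaussian (μ := 0)
    (posSemidef_kronecker_one (n := n) hSig) (i := (a, i))).hasLaw.comp hE
  simpa [Function.comp_def, vec] using h

theorem IsNormalError.hasGaussianLaw (hE : IsNormalError Sig E P) :
    HasGaussianLaw (fun ω (i : Fin n) (a : Fin p) => E ω i a) P := by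
  have h := HasLaw.hasGaussianLaw hE
  let L : EuclideanSpace ℝ (Fin p × Fin n) →L[ℝ] (Fin n → Fin p → ℝ) :=
    ContinuousLinearMap.pi fun i => ContinuousLinearMap.pi fun a =>
      EuclideanSpace.proj (a, i)
  exact h.map_fun L

theorem IsNormalError.hasGaussianLaw_entry (hE : IsNormalError Sig E P) (i : Fin n) (a : Fin p) :
    HasGaussianLaw (fun ω => E ω i a) P :=
  (hE.hasGaussianLaw.eval i).eval a

theorem IsNormalError.integral_entry (hSig : Sig.PosSemidef) (hE : IsNormalError Sig E P)
    (i : Fin n) (a : Fin p) : ∫ ω, E ω i a ∂P = 0 := by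
  have := (hE.hasLaw_entry hSig i a).integral_eq
  simpa using this

theorem IsNormalError.covariance_entry (hSig : Sig.PosSemidef) (hE : IsNormalError Sig E P)
    (i j : Fin n) (a b : Fin p) :
    cov[fun ω => E ω i a, fun ω => E ω j b; P] = Sig a b * (1 : Matrix (Fin n) (Fin n) ℝ) i j := by
  have h := HasLaw.covariance_fun_comp hE (f := fun x => x (a, i)) (g := fun x => x (b, j))
    (by fun_prop) (by fun_prop)
  rw [covariance_eval_multivariateGaussian (posSemidef_kronecker_one hSig)] at h
  simpa [vec, kroneckerMap_apply] using h

theorem IsNormalError.iIndepFun_rows (hSig : Sig.PosSemidef) (hE : IsNormalError Sig E P) :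
    iIndepFun (fun i ω a => E ω i a) P :=
  HasGaussianLaw.iIndepFun_of_covariance_eval (X := fun i a ω => E ω i a) hE.hasGaussianLaw
    fun i j hij a b => by rw [hE.covariance_entry hSig, one_apply_ne hij, mul_zero]

theorem IsNormalError.memLp_sum_mul (hE : IsNormalError Sig E P) (x : Fin n → ℝ) (a : Fin p) :
    MemLp (fun ω => ∑ i, x i * E ω i a) 2 P :=
  memLp_finsetSum _ fun i _ => (hE.hasGaussianLaw_entry i a).memLp_two.const_mul _

theorem IsNormalError.integral_sum_mul (hSig : Sig.PosSemidef) (hE : IsNormalError Sig E P)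
    (x : Fin n → ℝ) (a : Fin p) : ∫ ω, ∑ i, x i * E ω i a ∂P = 0 := by
  rw [integral_finsetSum _ fun i _ => (hE.hasGaussianLaw_entry i a).integrable.const_mul _]
  simp [integral_const_mul, hE.integral_entry hSig]

theorem IsNormalError.memLp_mul (hE : IsNormalError Sig E P) (i : Fin n) (a b : Fin p) :
    MemLp (fun ω => E ω i a * E ω i b) 2 P := by
  have : ENNReal.HolderTriple 4 4 2 := ⟨by
    rw [← two_mul, ← ENNReal.toReal_eq_toReal_iff' (by finiteness) (by finiteness)]
    norm_num⟩
  exact ((hE.hasGaussianLaw_entry i b).memLp (p := 4) (by norm_num)).mul'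
    ((hE.hasGaussianLaw_entry i a).memLp (p := 4) (by norm_num))

theorem IsNormalError.integrable_pow_four (hE : IsNormalError Sig E P) (i : Fin n) (a : Fin p) :
    Integrable (fun ω => E ω i a ^ 4) P := by
  have h : MemLp (fun ω => E ω i a) (4 : ℕ) P := (hE.hasGaussianLaw_entry i a).memLp (by norm_num)
  simpa [Even.pow_abs (show Even 4 by decide)] using h.integrable_norm_pow (by norm_num)

variable [IsProbabilityMeasure P]

theorem IsNormalError.variance_sum_mul (hSig : Sig.PosSemidef) (hE : IsNormalError Sig E P)
    (x : Fin n → ℝ) (a : Fin p) :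
    Var[fun ω => ∑ i, x i * E ω i a; P] = (∑ i, x i * x i) * Sig a a := by
  rw [variance_fun_sum fun i => (hE.hasGaussianLaw_entry i a).memLp_two.const_mul _]
  simp_rw [covariance_const_mul_left, covariance_const_mul_right, hE.covariance_entry hSig,
    one_apply]
  simp [Finset.sum_mul, mul_assoc]

theorem IsNormalError.integral_mul (hSig : Sig.PosSemidef) (hE : IsNormalError Sig E P)
    (i : Fin n) (a b : Fin p) : ∫ ω, E ω i a * E ω i b ∂P = Sig a b := by
  have h := covariance_eq_sub (hE.hasGaussianLaw_entry i a).memLp_two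
    (hE.hasGaussianLaw_entry i b).memLp_two
  rw [hE.covariance_entry hSig, hE.integral_entry hSig] at h
  simpa using h.symm

theorem IsNormalError.integral_sum_entry_mul (hSig : Sig.PosSemidef) (hE : IsNormalError Sig E P)
    (a b : Fin p) : ∫ ω, ∑ i, E ω i a * E ω i b ∂P = n * Sig a b := by
  rw [integral_finsetSum _ fun i _ => (hE.memLp_mul i a b).integrable (by norm_num)]
  simp [hE.integral_mul hSig]

/-- A bound for the variance of a product of two entries of a row; it depends only on `Sig`
and comes from `(x y)² ≤ x⁴ + y⁴`. -/
noncomputable def fourthMomentBound (Sig : Matrix (Fin p) (Fin p) ℝ) (a b : Fin p) : ℝ :=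
  ∫ x, x ^ 4 ∂(gaussianReal 0 (Sig a a).toNNReal) + ∫ x, x ^ 4 ∂(gaussianReal 0 (Sig b b).toNNReal)

theorem IsNormalError.variance_mul_le (hSig : Sig.PosSemidef) (hE : IsNormalError Sig E P)
    (i : Fin n) (a b : Fin p) :
    Var[fun ω => E ω i a * E ω i b; P] ≤ fourthMomentBound Sig a b := by
  have h4 (c : Fin p) : ∫ ω, E ω i c ^ 4 ∂P = ∫ x, x ^ 4 ∂(gaussianReal 0 (Sig c c).toNNReal) :=
    (hE.hasLaw_entry hSig i c).integral_comp (f := fun x => x ^ 4) (by fun_prop)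
  refine (variance_le_expectation_sq (hE.memLp_mul i a b).1).trans ?_
  rw [fourthMomentBound, ← h4, ← h4, ← integral_add (hE.integrable_pow_four i a)
    (hE.integrable_pow_four i b)]
  refine integral_mono (hE.memLp_mul i a b).integrable_sq
    ((hE.integrable_pow_four i a).add (hE.integrable_pow_four i b)) fun ω => ?_
  simp only [Pi.pow_apply]
  nlinarith [sq_nonneg (E ω i a ^ 2 - E ω i b ^ 2), sq_nonneg (E ω i a ^ 2),
    sq_nonneg (E ω i b ^ 2)]

theorem IsNormalError.variance_sum_entry_mul_le (hSig : Sig.PosSemidef)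
    (hE : IsNormalError Sig E P) (a b : Fin p) :
    Var[fun ω => ∑ i, E ω i a * E ω i b; P] ≤ n * fourthMomentBound Sig a b := by
  have h := IndepFun.variance_sum (μ := P) (X := fun i ω => E ω i a * E ω i b)
    (s := (Finset.univ : Finset (Fin n))) (fun i _ => hE.memLp_mul i a b) (by
      intro i _ j _ hij
      exact ((hE.iIndepFun_rows hSig).indepFun hij).comp
        (φ := fun r : Fin p → ℝ => r a * r b) (ψ := fun r : Fin p → ℝ => r a * r b)
        (by fun_prop) (by fun_prop))
  have h2 : (∑ i, fun ω => E ω i a * E ω i b) = fun ω => ∑ i, E ω i a * E ω i b := by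
    ext ω; simp
  rw [← h2, h]
  refine (Finset.sum_le_sum fun i _ => hE.variance_mul_le hSig i a b).trans ?_
  simp

end NormalError

/-! ### Laws of large numbers -/

section LawsOfLargeNumbers

variable {p : ℕ} {Ω : ℕ → Type*} [∀ n, MeasurableSpace (Ω n)] {P : ∀ n, Measure (Ω n)}
  [∀ n, IsProbabilityMeasure (P n)] {Sig : Matrix (Fin p) (Fin p) ℝ}
  {E : ∀ n : ℕ, Ω n → Matrix (Fin n) (Fin p) ℝ}

theorem tendsto_weighted_mean_error (hSig : Sig.PosSemidef)
    (hE : ∀ n, IsNormalError Sig (E n) (P n)) (x : ∀ n, Fin n → ℝ) {m : ℝ}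
    (hx : Tendsto (fun n : ℕ => (n : ℝ)⁻¹ * ∑ i, x n i * x n i) atTop (𝓝 m)) (a : Fin p) :
    Tendsto (fun z : Σ n, Ω n => (z.1 : ℝ)⁻¹ * ∑ i, x z.1 i * E z.1 z.2 i a)
      (highProbability P) (𝓝 0) := by
  refine tendsto_highProbability_of_variance
    (Z := fun n ω => (n : ℝ)⁻¹ * ∑ i, x n i * E n ω i a)
    (fun n => ((hE n).memLp_sum_mul _ _).const_mul _)
    (Eventually.of_forall fun n => ?_) ?_
  · rw [integral_const_mul, (hE n).integral_sum_mul hSig, mul_zero]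
  · have h := (tendsto_inv_atTop_nhds_zero_nat (𝕜 := ℝ)).mul (hx.mul_const (Sig a a))
    rw [zero_mul] at h
    refine h.congr fun n => ?_
    rw [variance_const_mul, (hE n).variance_sum_mul hSig]
    ring

theorem tendsto_second_moment_error (hSig : Sig.PosSemidef)
    (hE : ∀ n, IsNormalError Sig (E n) (P n)) (a b : Fin p) :
    Tendsto (fun z : Σ n, Ω n => (z.1 : ℝ)⁻¹ * ∑ i, E z.1 z.2 i a * E z.1 z.2 i b)
      (highProbability P) (𝓝 (Sig a b)) := by
  refine tendsto_highProbability_of_variance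
    (Z := fun n ω => (n : ℝ)⁻¹ * ∑ i, E n ω i a * E n ω i b)
    (fun n => (memLp_finsetSum _ fun i _ => (hE n).memLp_mul i a b).const_mul _) ?_ ?_
  · filter_upwards [eventually_ne_atTop 0] with n hn
    rw [integral_const_mul, (hE n).integral_sum_entry_mul hSig,
      inv_mul_cancel_left₀ (Nat.cast_ne_zero.2 hn)]
  · have h := (tendsto_inv_atTop_nhds_zero_nat (𝕜 := ℝ)).mul_const (fourthMomentBound Sig a b)
    rw [zero_mul] at h
    refine tendsto_of_tendsto_of_tendsto_of_le_of_le' tendsto_const_nhds h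
      (Eventually.of_forall fun n => variance_nonneg _ _) ?_
    filter_upwards [eventually_ne_atTop 0] with n hn
    have hn' : (n : ℝ) ≠ 0 := Nat.cast_ne_zero.2 hn
    rw [variance_const_mul]
    calc _ ≤ ((n : ℝ)⁻¹) ^ 2 * (n * fourthMomentBound Sig a b) := by
          gcongr; exact (hE n).variance_sum_entry_mul_le hSig a b
      _ = _ := by field_simp

end LawsOfLargeNumbers

/-! ### Rayleigh quotients -/

section Rayleigh

variable {p : ℕ} {A : Matrix (Fin p) (Fin p) ℝ}

theorem dotProduct_mulVec_eq_mulVec_dotProduct (hA : A.IsHermitian) (x y : Fin p → ℝ) :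
    x ⬝ᵥ A *ᵥ y = A *ᵥ x ⬝ᵥ y := by
  have h : Aᵀ = A := hA
  rw [dotProduct_mulVec, ← mulVec_transpose, h]

theorem eigenvectorBasis_dotProduct_mulVec (hA : A.IsHermitian) (i : Fin p) (x : Fin p → ℝ) :
    (hA.eigenvectorBasis i).ofLp ⬝ᵥ A *ᵥ x =
      hA.eigenvalues i * ((hA.eigenvectorBasis i).ofLp ⬝ᵥ x) := by
  rw [dotProduct_mulVec_eq_mulVec_dotProduct hA, hA.mulVec_eigenvectorBasis,
    smul_dotProduct, smul_eq_mul]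

theorem sum_eigenvectorBasis_dotProduct_mul (hA : A.IsHermitian) (x y : Fin p → ℝ) :
    ∑ i, ((hA.eigenvectorBasis i).ofLp ⬝ᵥ x) * ((hA.eigenvectorBasis i).ofLp ⬝ᵥ y) = x ⬝ᵥ y := by
  have h := hA.eigenvectorBasis.sum_inner_mul_inner (WithLp.toLp 2 x) (WithLp.toLp 2 y)
  simp only [EuclideanSpace.inner_eq_star_dotProduct, star_trivial] at h
  rw [dotProduct_comm x y, ← h]
  exact Finset.sum_congr rfl fun i _ => by rw [dotProduct_comm y]

/-- The quadratic form of a symmetric matrix in its eigenbasis. -/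
theorem dotProduct_mulVec_eq_sum (hA : A.IsHermitian) (x : Fin p → ℝ) :
    x ⬝ᵥ A *ᵥ x =
      ∑ i, hA.eigenvalues i * ((hA.eigenvectorBasis i).ofLp ⬝ᵥ x) ^ 2 := by
  rw [← sum_eigenvectorBasis_dotProduct_mul hA]
  refine Finset.sum_congr rfl fun i _ => ?_
  rw [eigenvectorBasis_dotProduct_mulVec]
  ring

theorem eigenvalues_le_eig1 (hp : 2 ≤ p) (hA : A.IsHermitian) (i : Fin p) :
    hA.eigenvalues i ≤ eig1 hp hA :=
  hA.eigenvalues₀_antitone (Fin.mk_le_of_le_val (Nat.zero_le _))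

theorem eig2_le_eig1 (hp : 2 ≤ p) (hA : A.IsHermitian) : eig2 hp hA ≤ eig1 hp hA :=
  hA.eigenvalues₀_antitone (Fin.mk_le_of_le_val (Nat.zero_le _))

/-- All eigenvalues but one, counted with multiplicity, are at most the second largest one. -/
theorem exists_forall_ne_eigenvalues_le_eig2 (hp : 2 ≤ p) (hA : A.IsHermitian) :
    ∃ i₀, ∀ i ≠ i₀, hA.eigenvalues i ≤ eig2 hp hA := by
  let e : Fin (Fintype.card (Fin p)) ≃ Fin p := Fintype.equivOfCardEq (Fintype.card_fin _)
  refine ⟨e (Fin.cast (Fintype.card_fin p).symm ⟨0, by omega⟩), fun i hi => ?_⟩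
  refine hA.eigenvalues₀_antitone ?_
  have h : (e.symm i).val ≠ 0 := by
    intro h
    exact hi (by rw [← Equiv.symm_apply_eq]; exact Fin.ext h)
  exact Nat.one_le_iff_ne_zero.2 h

theorem dotProduct_mulVec_le_eig1 (hp : 2 ≤ p) (hA : A.IsHermitian) (x : Fin p → ℝ) :
    x ⬝ᵥ A *ᵥ x ≤ eig1 hp hA * (x ⬝ᵥ x) := by
  rw [dotProduct_mulVec_eq_sum hA, ← sum_eigenvectorBasis_dotProduct_mul hA x x, Finset.mul_sum]
  refine Finset.sum_le_sum fun i _ => ?_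
  rw [← pow_two]
  exact mul_le_mul_of_nonneg_right (eigenvalues_le_eig1 hp hA i) (sq_nonneg _)

theorem dotProduct_self_eq_one {g : EuclideanSpace ℝ (Fin p)} (hg : ‖g‖ = 1) :
    g.ofLp ⬝ᵥ g.ofLp = 1 := by
  have h := EuclideanSpace.real_norm_sq_eq g
  rw [hg] at h
  simpa [dotProduct, pow_two] using h.symm

theorem IsFirstPrincipalEigenvector.dotProduct_mulVec_self {hp : 2 ≤ p} {hA : A.IsHermitian}
    {g : EuclideanSpace ℝ (Fin p)} (hg : IsFirstPrincipalEigenvector hp hA g) :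
    g.ofLp ⬝ᵥ A *ᵥ g.ofLp = eig1 hp hA := by
  rw [hg.2, dotProduct_smul, dotProduct_self_eq_one hg.1, smul_eq_mul, mul_one]

/-- The Rayleigh quotient splits along the principal eigenvector when the largest eigenvalue is
simple: the part of `x` orthogonal to it contributes at most the second eigenvalue. -/
theorem IsFirstPrincipalEigenvector.dotProduct_mulVec_le {hp : 2 ≤ p} {hA : A.IsHermitian}
    {γ : EuclideanSpace ℝ (Fin p)} (hγ : IsFirstPrincipalEigenvector hp hA γ)
    (hgap : eig2 hp hA < eig1 hp hA) (x : Fin p → ℝ) :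
    x ⬝ᵥ A *ᵥ x ≤ eig1 hp hA * (γ.ofLp ⬝ᵥ x) ^ 2 +
      eig2 hp hA * (x ⬝ᵥ x - (γ.ofLp ⬝ᵥ x) ^ 2) := by
  obtain ⟨i₀, hi₀⟩ := exists_forall_ne_eigenvalues_le_eig2 hp hA
  have horth (i : Fin p) (hi : i ≠ i₀) : (hA.eigenvectorBasis i).ofLp ⬝ᵥ γ.ofLp = 0 := by
    have h := eigenvectorBasis_dotProduct_mulVec hA i γ.ofLp
    rw [hγ.2, dotProduct_smul, smul_eq_mul] at h
    have h2 := hi₀ i hi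
    by_contra h0
    have := mul_right_cancel₀ h0 h
    linarith
  have hsum (y : Fin p → ℝ) : γ.ofLp ⬝ᵥ y =
      ((hA.eigenvectorBasis i₀).ofLp ⬝ᵥ γ.ofLp) * ((hA.eigenvectorBasis i₀).ofLp ⬝ᵥ y) := by
    rw [← sum_eigenvectorBasis_dotProduct_mul hA]
    refine Finset.sum_eq_single i₀ (fun i _ hi => ?_) (by simp)
    rw [horth i hi, zero_mul]
  have hone := hsum γ.ofLp
  rw [dotProduct_self_eq_one hγ.1] at hone
  have hc : (γ.ofLp ⬝ᵥ x) ^ 2 = ((hA.eigenvectorBasis i₀).ofLp ⬝ᵥ x) ^ 2 := by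
    rw [hsum x, mul_pow, pow_two (_ ⬝ᵥ γ.ofLp), ← hone, one_mul]
  rw [dotProduct_mulVec_eq_sum hA, ← sum_eigenvectorBasis_dotProduct_mul hA x x, hc,
    ← Finset.add_sum_erase _ _ (Finset.mem_univ i₀),
    ← Finset.add_sum_erase _ (fun i => ((hA.eigenvectorBasis i).ofLp ⬝ᵥ x) *
      ((hA.eigenvectorBasis i).ofLp ⬝ᵥ x)) (Finset.mem_univ i₀), ← pow_two, add_sub_cancel_left,
    Finset.mul_sum]
  refine add_le_add (mul_le_mul_of_nonneg_right (eigenvalues_le_eig1 hp hA i₀) (sq_nonneg _))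
    (Finset.sum_le_sum fun i hi => ?_)
  rw [← pow_two]
  exact mul_le_mul_of_nonneg_right (hi₀ i (Finset.ne_of_mem_erase hi)) (sq_nonneg _)

end Rayleigh

/-! ### Perturbation of the principal eigenvector -/

section Perturbation

variable {p : ℕ}

/-- The entrywise `ℓ¹` size of a matrix, which dominates its quadratic form on unit vectors. -/
noncomputable def entrySum (D : Matrix (Fin p) (Fin p) ℝ) : ℝ := ∑ i, ∑ j, |D i j|

theorem abs_dotProduct_mulVec_le_entrySum (D : Matrix (Fin p) (Fin p) ℝ)
    {g : EuclideanSpace ℝ (Fin p)} (hg : ‖g‖ = 1) :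
    |g.ofLp ⬝ᵥ D *ᵥ g.ofLp| ≤ entrySum D := by
  have h1 (i : Fin p) : |g.ofLp i| ≤ 1 := by
    simpa [hg] using PiLp.norm_apply_le g i
  simp only [dotProduct, mulVec, entrySum, Finset.mul_sum]
  refine (Finset.abs_sum_le_sum_abs _ _).trans (Finset.sum_le_sum fun i _ => ?_)
  refine (Finset.abs_sum_le_sum_abs _ _).trans (Finset.sum_le_sum fun j _ => ?_)
  rw [abs_mul, abs_mul]
  have := mul_le_mul (h1 i) (h1 j) (abs_nonneg _) zero_le_one
  nlinarith [abs_nonneg (D i j)]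

theorem entrySum_tendsto_zero {ι : Type*} {l : Filter ι} {A : ι → Matrix (Fin p) (Fin p) ℝ}
    {B : Matrix (Fin p) (Fin p) ℝ} (h : Tendsto A l (𝓝 B)) :
    Tendsto (fun x => entrySum (A x - B)) l (𝓝 0) := by
  have hc : Continuous (entrySum (p := p)) := by
    unfold entrySum
    fun_prop
  have := (hc.tendsto (B - B)).comp (h.sub_const B)
  simpa [entrySum, Function.comp_def] using this

theorem signError_sq_le {g γ : EuclideanSpace ℝ (Fin p)} (hg : ‖g‖ = 1) (hγ : ‖γ‖ = 1) :
    signError g γ ^ 2 ≤ 2 * (1 - (γ.ofLp ⬝ᵥ g.ofLp) ^ 2) := by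
  have hin : inner ℝ g γ = γ.ofLp ⬝ᵥ g.ofLp := by
    simp [EuclideanSpace.inner_eq_star_dotProduct]
  have hle : |γ.ofLp ⬝ᵥ g.ofLp| ≤ 1 := by
    rw [← hin]
    simpa [hg, hγ] using abs_real_inner_le_norm g γ
  have h0 : 0 ≤ signError g γ := le_min (norm_nonneg _) (norm_nonneg _)
  have h1 : signError g γ ^ 2 ≤ 2 + 2 * (γ.ofLp ⬝ᵥ g.ofLp) := by
    refine (pow_le_pow_left₀ h0 (min_le_left _ _) 2).trans ?_
    rw [norm_sub_sq_real, inner_smul_left, norm_smul, hin, hg, hγ]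
    norm_num
    linarith
  have h2 : signError g γ ^ 2 ≤ 2 - 2 * (γ.ofLp ⬝ᵥ g.ofLp) := by
    refine (pow_le_pow_left₀ h0 (min_le_right _ _) 2).trans ?_
    rw [norm_sub_sq_real, inner_smul_left, norm_smul, hin, hg, hγ]
    norm_num
    linarith
  obtain ⟨h3, h4⟩ := abs_le.1 hle
  -- `1 - t² = (1 - t)(1 + t)` dominates `1 - |t|` on `[-1, 1]`.
  rcases le_total 0 (γ.ofLp ⬝ᵥ g.ofLp) with h | h <;> nlinarith

/-- If `A` is close to `δ γ γ'` and `B` is close to a matrix whose largest eigenvalue is simple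
with eigenvector `γ`, then every unit vector at which a convex combination of `A` and `B` has a
quadratic form as large as at `γ` is close to `γ` or `-γ`. The bound is uniform in the weight, since both limits favour
`γ` by at least the smaller of `δ` and the eigenvalue gap. -/
theorem gap_mul_le_of_convexCombination {hp : 2 ≤ p} {A B Sig : Matrix (Fin p) (Fin p) ℝ}
    {hSig : Sig.IsHermitian} {γ g : EuclideanSpace ℝ (Fin p)}
    (hγ : IsFirstPrincipalEigenvector hp hSig γ) (hgap : eig2 hp hSig < eig1 hp hSig)
    {δ w : ℝ} (hw0 : 0 ≤ w) (hw1 : w ≤ 1) (hg : ‖g‖ = 1)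
    (hle : γ.ofLp ⬝ᵥ ((1 - w) • A + w • B) *ᵥ γ.ofLp ≤
      g.ofLp ⬝ᵥ ((1 - w) • A + w • B) *ᵥ g.ofLp) :
    min δ (eig1 hp hSig - eig2 hp hSig) * (1 - (γ.ofLp ⬝ᵥ g.ofLp) ^ 2) ≤
      2 * (entrySum (A - δ • vecMulVec γ.ofLp γ.ofLp) + entrySum (B - Sig)) := by
  have hγγ := dotProduct_self_eq_one hγ.1
  have hgg := dotProduct_self_eq_one hg
  set t := γ.ofLp ⬝ᵥ g.ofLp with ht
  have ht2 : t ^ 2 ≤ 1 := by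
    have hle : |inner ℝ g γ| ≤ 1 := by simpa [hg, hγ.1] using abs_real_inner_le_norm g γ
    have hin : inner ℝ g γ = t := by simp [ht, EuclideanSpace.inner_eq_star_dotProduct]
    rw [hin] at hle
    nlinarith [abs_le.1 hle]
  -- the two limiting quadratic forms at `γ` and at `g`
  have hR (x : Fin p → ℝ) : x ⬝ᵥ (δ • vecMulVec γ.ofLp γ.ofLp) *ᵥ x = δ * (γ.ofLp ⬝ᵥ x) ^ 2 := by
    rw [smul_mulVec, vecMulVec_mulVec, dotProduct_smul, dotProduct_smul]
    simp [dotProduct_comm x, pow_two]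
  have hS := hγ.dotProduct_mulVec_le hgap g.ofLp
  have hSγ := hγ.dotProduct_mulVec_self
  rw [hgg, ← ht] at hS
  have hA (x : Fin p → ℝ) : x ⬝ᵥ A *ᵥ x =
      x ⬝ᵥ (A - δ • vecMulVec γ.ofLp γ.ofLp) *ᵥ x + δ * (γ.ofLp ⬝ᵥ x) ^ 2 := by
    rw [sub_mulVec, dotProduct_sub, hR]; ring
  have hB (x : Fin p → ℝ) : x ⬝ᵥ B *ᵥ x = x ⬝ᵥ (B - Sig) *ᵥ x + x ⬝ᵥ Sig *ᵥ x := by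
    rw [sub_mulVec, dotProduct_sub]; ring
  simp only [add_mulVec, smul_mulVec, dotProduct_add, dotProduct_smul, smul_eq_mul] at hle
  rw [hA, hA, hB, hB, hγγ, hSγ, ← ht] at hle
  have a1 := abs_le.1 (abs_dotProduct_mulVec_le_entrySum (A - δ • vecMulVec γ.ofLp γ.ofLp) hγ.1)
  have a2 := abs_le.1 (abs_dotProduct_mulVec_le_entrySum (A - δ • vecMulVec γ.ofLp γ.ofLp) hg)
  have a3 := abs_le.1 (abs_dotProduct_mulVec_le_entrySum (B - Sig) hγ.1)
  have a4 := abs_le.1 (abs_dotProduct_mulVec_le_entrySum (B - Sig) hg)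
  generalize γ.ofLp ⬝ᵥ (A - δ • vecMulVec γ.ofLp γ.ofLp) *ᵥ γ.ofLp = r1 at *
  generalize g.ofLp ⬝ᵥ (A - δ • vecMulVec γ.ofLp γ.ofLp) *ᵥ g.ofLp = r2 at *
  generalize γ.ofLp ⬝ᵥ (B - Sig) *ᵥ γ.ofLp = r3 at *
  generalize g.ofLp ⬝ᵥ (B - Sig) *ᵥ g.ofLp = r4 at *
  generalize entrySum (A - δ • vecMulVec γ.ofLp γ.ofLp) = s1 at *
  generalize entrySum (B - Sig) = s2 at *
  have hw1' : 0 ≤ 1 - w := sub_nonneg.2 hw1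
  have b1 : (1 - w) * (r2 - r1) ≤ 2 * s1 :=
    calc (1 - w) * (r2 - r1) ≤ (1 - w) * (2 * s1) := by gcongr; linarith
      _ ≤ 1 * (2 * s1) := by gcongr <;> linarith
      _ = _ := one_mul _
  have b2 : w * (r4 - r3) ≤ 2 * s2 :=
    calc w * (r4 - r3) ≤ w * (2 * s2) := by gcongr; linarith
      _ ≤ 1 * (2 * s2) := by gcongr; linarith
      _ = _ := one_mul _
  have ht2' : 0 ≤ 1 - t ^ 2 := sub_nonneg.2 ht2
  have c1 := mul_le_mul_of_nonneg_left (mul_le_mul_of_nonneg_right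
    (min_le_left δ (eig1 hp hSig - eig2 hp hSig)) ht2') hw1'
  have c2 := mul_le_mul_of_nonneg_left (mul_le_mul_of_nonneg_right
    (min_le_right δ (eig1 hp hSig - eig2 hp hSig)) ht2') hw0
  have c3 := mul_le_mul_of_nonneg_left hS hw0
  linarith

end Perturbation

/-! ### Sums of squares under the model -/

section SumsOfSquares

variable {n p q : ℕ}

theorem inv_smul_SR {X : Matrix (Fin n) (Fin q) ℝ} (hn : n ≠ 0) (hX : IsUnit (Xᵀ * X).det)
    (Y : Matrix (Fin n) (Fin p) ℝ) :
    (n : ℝ)⁻¹ • SR X Y =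
      ((n : ℝ)⁻¹ • (Xᵀ * Y))ᵀ * ((n : ℝ)⁻¹ • (Xᵀ * X))⁻¹ * ((n : ℝ)⁻¹ • (Xᵀ * Y)) := by
  have hn' : (n : ℝ) ≠ 0 := Nat.cast_ne_zero.2 hn
  let u : ℝˣ := (Units.mk0 (n : ℝ) hn')⁻¹
  have hu : ((n : ℝ)⁻¹ • (Xᵀ * X))⁻¹ = (n : ℝ) • (Xᵀ * X)⁻¹ := by
    have := Matrix.inv_smul' _ u hX
    simpa [u, Units.smul_def] using this
  rw [hu]
  simp only [SR, hatMatrix, transpose_smul, transpose_mul, transpose_transpose,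
    Matrix.smul_mul, Matrix.mul_smul, smul_smul, Matrix.mul_assoc]
  rw [mul_inv_cancel₀ hn', mul_one]

theorem inv_smul_transpose_mul_response {X : Matrix (Fin n) (Fin q) ℝ}
    (hX : Xᵀ *ᵥ (fun _ => (1 : ℝ)) = 0) (μ : Fin p → ℝ) (α : Fin q → ℝ)
    (γ : EuclideanSpace ℝ (Fin p)) (E : Matrix (Fin n) (Fin p) ℝ) :
    (n : ℝ)⁻¹ • (Xᵀ * response μ α γ X E) =
      ((n : ℝ)⁻¹ • (Xᵀ * X)) * vecMulVec α γ.ofLp + (n : ℝ)⁻¹ • (Xᵀ * E) := by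
  rw [response, Matrix.mul_add, Matrix.mul_add, mul_vecMulVec, hX, zero_vecMulVec, zero_add,
    smul_add, ← Matrix.mul_assoc, Matrix.smul_mul]

/-- The residual projection annihilates the mean structure, so that the residual sum of squares
depends on the errors alone. -/
theorem inv_smul_SE_response {X : Matrix (Fin n) (Fin q) ℝ} (hn : n ≠ 0)
    (hX : Xᵀ *ᵥ (fun _ => (1 : ℝ)) = 0) (hdet : IsUnit (Xᵀ * X).det) (μ : Fin p → ℝ)
    (α : Fin q → ℝ) (γ : EuclideanSpace ℝ (Fin p)) (E : Matrix (Fin n) (Fin p) ℝ) :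
    (n : ℝ)⁻¹ • SE X (response μ α γ X E) = (n : ℝ)⁻¹ • (Eᵀ * E) -
      vecMulVec ((n : ℝ)⁻¹ • Eᵀ *ᵥ (fun _ => 1)) ((n : ℝ)⁻¹ • Eᵀ *ᵥ (fun _ => 1)) -
      (n : ℝ)⁻¹ • SR X E := by
  have hn' : (n : ℝ) ≠ 0 := Nat.cast_ne_zero.2 hn
  let one : Fin n → ℝ := fun _ => 1
  let R : Matrix (Fin n) (Fin n) ℝ := 1 - (1 / (n : ℝ)) • vecMulVec one one - hatMatrix X
  have hRt : Rᵀ = R := by simp [R, hatMatrix_transpose, transpose_vecMulVec]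
  have hR1 : R *ᵥ one = 0 := by
    have h1 : hatMatrix X *ᵥ one = 0 := by
      rw [hatMatrix, ← mulVec_mulVec, hX, mulVec_zero]
    have h2 : one ⬝ᵥ one = n := by simp [one, dotProduct]
    simp only [R, sub_mulVec, h1, one_mulVec, smul_mulVec, vecMulVec_mulVec, h2]
    ext i
    simp [one, hn']
  have hRX : R * X = 0 := by
    have h1 : hatMatrix X * X = X := by
      rw [hatMatrix, Matrix.mul_assoc, Matrix.mul_assoc, nonsing_inv_mul _ hdet, Matrix.mul_one]
    have h2 : one ᵥ* X = 0 := by rw [← mulVec_transpose]; exact hX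
    have h3 : vecMulVec one (0 : Fin q → ℝ) = 0 := by ext; simp [vecMulVec_apply]
    rw [Matrix.sub_mul, Matrix.sub_mul, h1, Matrix.smul_mul, vecMulVec_mul, h2, h3,
      smul_zero, Matrix.one_mul, sub_zero, sub_self]
  let D : Matrix (Fin n) (Fin p) ℝ := vecMulVec one μ + X * vecMulVec α γ.ofLp
  have hRD : R * D = 0 := by
    rw [Matrix.mul_add, mul_vecMulVec, hR1, zero_vecMulVec, ← Matrix.mul_assoc, hRX,
      Matrix.zero_mul, add_zero]
  have hDR : Dᵀ * R = 0 := by rw [← hRt, ← transpose_mul, hRD, transpose_zero]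
  have hSE : SE X (response μ α γ X E) = Eᵀ * R * E := by
    change (D + E)ᵀ * R * (D + E) = _
    rw [transpose_add, Matrix.add_mul, hDR, zero_add, Matrix.mul_add, Matrix.mul_assoc, hRD,
      Matrix.mul_zero, zero_add]
  have h3 : Eᵀ * vecMulVec one one * E = vecMulVec (Eᵀ *ᵥ one) (Eᵀ *ᵥ one) := by
    rw [mul_vecMulVec, vecMulVec_mul, mulVec_transpose E one]
  rw [hSE]
  simp only [R, Matrix.mul_sub, Matrix.sub_mul, Matrix.mul_one, Matrix.mul_smul, Matrix.smul_mul,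
    h3, smul_sub, smul_smul, SR, vecMulVec_smul, smul_vecMulVec, one_div, one]

theorem trace_sq_nonneg_of_isHermitian {A : Matrix (Fin p) (Fin p) ℝ} (hA : A.IsHermitian) :
    0 ≤ (A ^ 2).trace := by
  have h : Aᵀ = A := hA
  rw [pow_two]
  nth_rewrite 1 [← h]
  simp only [trace, diag, mul_apply, transpose_apply]
  exact Finset.sum_nonneg fun i _ => Finset.sum_nonneg fun j _ => mul_self_nonneg _

/-- The term subtracted in the estimator of `tr Σ²` never exceeds `(tr Σ̂)²`. -/
theorem aHat_nonneg (hn : q + 3 ≤ n) (X : Matrix (Fin n) (Fin q) ℝ)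
    (Y : Matrix (Fin n) (Fin p) ℝ) : 0 ≤ aHat X Y := by
  have hT := trace_sq_nonneg_of_isHermitian (SE_isHermitian X Y)
  obtain ⟨m, hm⟩ : ∃ m : ℝ, m = (n : ℝ) - 1 - q := ⟨_, rfl⟩
  have hm2 : 2 ≤ m := by
    have : ((q + 3 : ℕ) : ℝ) ≤ n := Nat.cast_le.2 hn
    push_cast at this
    linarith
  have e1 : (n : ℝ) + 1 - q = m + 2 := by rw [hm]; ring
  have e2 : (n : ℝ) - 2 - q = m - 1 := by rw [hm]; ring
  rw [aHat, trSqHat, sigmaHat, e1, e2, ← hm, trace_smul, smul_eq_mul]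
  generalize (SE X Y ^ 2).trace = T at *
  generalize (SE X Y).trace = t
  have hm0 : 0 < m := by linarith
  have hK : 0 < (m + 2) * (m - 1) := mul_pos (by linarith) (by linarith)
  have hmK : m ≤ (m + 2) * (m - 1) := by nlinarith
  have h1 : 1 / ((m + 2) * (m - 1)) * (t ^ 2 / m) ≤ (1 / m * t) ^ 2 :=
    calc 1 / ((m + 2) * (m - 1)) * (t ^ 2 / m) ≤ 1 / m * (t ^ 2 / m) := by gcongr
      _ = _ := by field_simp
  have h2 : 0 ≤ 1 / ((m + 2) * (m - 1)) * T := by positivity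
  rw [mul_sub]
  linarith

theorem wHat_mem_Icc (hp : 2 ≤ p) {X : Matrix (Fin n) (Fin q) ℝ} {Y : Matrix (Fin n) (Fin p) ℝ}
    (ha : 0 ≤ aHat X Y) (hb : 0 ≤ bHat hp X Y) (hc : 0 ≤ cHat X Y) :
    wHat hp X Y ∈ Set.Icc (0 : ℝ) 1 := by
  have hd : 0 ≤ dHat hp X Y := sub_nonneg.2 (eig2_le_eig1 hp _)
  have h1 : 0 ≤ aHat X Y * dHat hp X Y * q := by positivity
  have h2 : 0 ≤ 2 * bHat hp X Y * cHat X Y * dHat hp X Y := by positivity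
  have h3 : 0 ≤ aHat X Y * cHat X Y := by positivity
  exact ⟨div_nonneg (by linarith) (by linarith), div_le_one_of_le₀ (by linarith) (by linarith)⟩

end SumsOfSquares

/-! ### Limits of the sums of squares and of the weight -/

section Limits

variable {p q : ℕ} {ι : Type*} {l : Filter ι} {N : ι → ℕ}

theorem tendsto_matrix_mul {r s t : ℕ} {A : ι → Matrix (Fin r) (Fin s) ℝ}
    {B : ι → Matrix (Fin s) (Fin t) ℝ} {a : Matrix (Fin r) (Fin s) ℝ}
    {b : Matrix (Fin s) (Fin t) ℝ} (hA : Tendsto A l (𝓝 a)) (hB : Tendsto B l (𝓝 b)) :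
    Tendsto (fun z => A z * B z) l (𝓝 (a * b)) := by
  have hc : Continuous fun x : Matrix (Fin r) (Fin s) ℝ × Matrix (Fin s) (Fin t) ℝ =>
      x.1 * x.2 := continuous_fst.matrix_mul continuous_snd
  exact (hc.tendsto (a, b)).comp (hA.prodMk_nhds hB)

theorem eventually_isUnit_det {X : ∀ z : ι, Matrix (Fin (N z)) (Fin q) ℝ}
    {M : Matrix (Fin q) (Fin q) ℝ} (hM : IsUnit M.det)
    (hXM : Tendsto (fun z => (N z : ℝ)⁻¹ • ((X z)ᵀ * X z)) l (𝓝 M)) :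
    ∀ᶠ z in l, IsUnit ((X z)ᵀ * X z).det := by
  have h1 : Tendsto (fun z => ((N z : ℝ)⁻¹ • ((X z)ᵀ * X z)).det) l (𝓝 M.det) :=
    ((continuous_id.matrix_det).tendsto M).comp hXM
  filter_upwards [h1.eventually_ne hM.ne_zero] with z hz
  rw [isUnit_iff_ne_zero]
  intro h0
  exact hz (by rw [det_smul, h0, mul_zero])

theorem tendsto_inv_smul_SR (hN : Tendsto N l atTop) {X : ∀ z : ι, Matrix (Fin (N z)) (Fin q) ℝ}
    {M : Matrix (Fin q) (Fin q) ℝ} (hM : IsUnit M.det)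
    (hXM : Tendsto (fun z => (N z : ℝ)⁻¹ • ((X z)ᵀ * X z)) l (𝓝 M))
    {Y : ∀ z : ι, Matrix (Fin (N z)) (Fin p) ℝ} {K : Matrix (Fin q) (Fin p) ℝ}
    (hK : Tendsto (fun z => (N z : ℝ)⁻¹ • ((X z)ᵀ * Y z)) l (𝓝 K)) :
    Tendsto (fun z => (N z : ℝ)⁻¹ • SR (X z) (Y z)) l (𝓝 (Kᵀ * M⁻¹ * K)) := by
  have hinv : Tendsto (fun z => ((N z : ℝ)⁻¹ • ((X z)ᵀ * X z))⁻¹) l (𝓝 M⁻¹) := by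
    refine (continuousAt_matrix_inv M ?_).tendsto.comp hXM
    rw [Ring.inverse_eq_inv']
    exact continuousAt_inv₀ hM.ne_zero
  have htr : Tendsto (fun z => ((N z : ℝ)⁻¹ • ((X z)ᵀ * Y z))ᵀ) l (𝓝 Kᵀ) :=
    ((continuous_id.matrix_transpose).tendsto K).comp hK
  have h3 := tendsto_matrix_mul (tendsto_matrix_mul htr hinv) hK
  refine h3.congr' ?_
  filter_upwards [hN.eventually_ne_atTop 0, eventually_isUnit_det hM hXM] with z hz hdet
  rw [inv_smul_SR hz hdet]

/-- The signal dominates the regression sum of squares, whose limit has rank one. -/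
theorem tendsto_inv_smul_SR_response (hN : Tendsto N l atTop)
    {X : ∀ z : ι, Matrix (Fin (N z)) (Fin q) ℝ} (hX : ∀ z, (X z)ᵀ *ᵥ (fun _ => (1 : ℝ)) = 0)
    {M : Matrix (Fin q) (Fin q) ℝ} (hM : M.PosDef)
    (hXM : Tendsto (fun z => (N z : ℝ)⁻¹ • ((X z)ᵀ * X z)) l (𝓝 M))
    {E : ∀ z : ι, Matrix (Fin (N z)) (Fin p) ℝ}
    (hXE : Tendsto (fun z => (N z : ℝ)⁻¹ • ((X z)ᵀ * E z)) l (𝓝 0))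
    (μ : Fin p → ℝ) (α : Fin q → ℝ) (γ : EuclideanSpace ℝ (Fin p)) :
    Tendsto (fun z => (N z : ℝ)⁻¹ • SR (X z) (response μ α γ (X z) (E z))) l
      (𝓝 ((α ⬝ᵥ M *ᵥ α) • vecMulVec γ.ofLp γ.ofLp)) := by
  have hdet : IsUnit M.det := hM.det_pos.ne'.isUnit
  have hMt : Mᵀ = M := hM.isHermitian
  have h1 : Tendsto (fun z => (N z : ℝ)⁻¹ • ((X z)ᵀ * X z) * vecMulVec α γ.ofLp) l
      (𝓝 (M * vecMulVec α γ.ofLp)) :=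
    tendsto_matrix_mul hXM tendsto_const_nhds
  have h2 : Tendsto (fun z => (N z : ℝ)⁻¹ • ((X z)ᵀ * response μ α γ (X z) (E z))) l
      (𝓝 (M * vecMulVec α γ.ofLp)) := by
    have := h1.add hXE
    rw [add_zero] at this
    exact this.congr fun z => (inv_smul_transpose_mul_response (hX z) μ α γ (E z)).symm
  have h3 := tendsto_inv_smul_SR hN hdet hXM h2
  convert h3 using 2
  rw [transpose_mul, hMt, transpose_vecMulVec, Matrix.mul_assoc, Matrix.mul_assoc,
    nonsing_inv_mul_cancel_left _ _ hdet, mul_vecMulVec, vecMulVec_mul_vecMulVec,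
    vecMulVec_smul]

theorem tendsto_inv_smul_SE_response (hN : Tendsto N l atTop)
    {X : ∀ z : ι, Matrix (Fin (N z)) (Fin q) ℝ} (hX : ∀ z, (X z)ᵀ *ᵥ (fun _ => (1 : ℝ)) = 0)
    {M : Matrix (Fin q) (Fin q) ℝ} (hM : M.PosDef)
    (hXM : Tendsto (fun z => (N z : ℝ)⁻¹ • ((X z)ᵀ * X z)) l (𝓝 M))
    {E : ∀ z : ι, Matrix (Fin (N z)) (Fin p) ℝ} {Sig : Matrix (Fin p) (Fin p) ℝ}
    (hXE : Tendsto (fun z => (N z : ℝ)⁻¹ • ((X z)ᵀ * E z)) l (𝓝 0))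
    (h1E : Tendsto (fun z => (N z : ℝ)⁻¹ • (E z)ᵀ *ᵥ (fun _ => (1 : ℝ))) l (𝓝 0))
    (hEE : Tendsto (fun z => (N z : ℝ)⁻¹ • ((E z)ᵀ * E z)) l (𝓝 Sig))
    (μ : Fin p → ℝ) (α : Fin q → ℝ) (γ : EuclideanSpace ℝ (Fin p)) :
    Tendsto (fun z => (N z : ℝ)⁻¹ • SE (X z) (response μ α γ (X z) (E z))) l (𝓝 Sig) := by
  have hdet : IsUnit M.det := hM.det_pos.ne'.isUnit
  have h1 := tendsto_inv_smul_SR hN hdet hXM hXE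
  have h2 : Tendsto (fun z => vecMulVec ((N z : ℝ)⁻¹ • (E z)ᵀ *ᵥ (fun _ => (1 : ℝ)))
      ((N z : ℝ)⁻¹ • (E z)ᵀ *ᵥ (fun _ => (1 : ℝ)))) l (𝓝 (vecMulVec 0 0)) :=
    ((continuous_id.matrix_vecMulVec continuous_id).tendsto (0 : Fin p → ℝ)).comp h1E
  have h3 := (hEE.sub h2).sub h1
  simp only [zero_vecMulVec, Matrix.mul_zero, sub_zero] at h3
  refine h3.congr' ?_
  filter_upwards [hN.eventually_ne_atTop 0, eventually_isUnit_det hdet hXM] with z hz hz2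
  rw [inv_smul_SE_response hz (hX z) hz2]

theorem tendsto_sigmaHat (hN : Tendsto N l atTop) {X : ∀ z : ι, Matrix (Fin (N z)) (Fin q) ℝ}
    {Y : ∀ z : ι, Matrix (Fin (N z)) (Fin p) ℝ} {Sig : Matrix (Fin p) (Fin p) ℝ}
    (hSE : Tendsto (fun z => (N z : ℝ)⁻¹ • SE (X z) (Y z)) l (𝓝 Sig)) :
    Tendsto (fun z => sigmaHat (X z) (Y z)) l (𝓝 Sig) := by
  have h1 : Tendsto (fun n : ℕ => (n : ℝ) / ((n : ℝ) + (-1 - q))) atTop (𝓝 1) :=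
    tendsto_natCast_div_add_atTop (-1 - (q : ℝ))
  have h2 := (h1.comp hN).smul hSE
  rw [one_smul] at h2
  refine h2.congr' ?_
  filter_upwards [hN.eventually_ne_atTop 0] with z hz
  have hz' : (N z : ℝ) ≠ 0 := Nat.cast_ne_zero.2 hz
  rw [sigmaHat, smul_smul, Function.comp_apply]
  congr 1
  rw [div_mul_eq_mul_div, mul_inv_cancel₀ hz', ← add_sub_assoc, ← sub_eq_add_neg]

/-- Only the nonnegativity of the four estimated quantities matters: it confines the weight to the
unit interval, whatever its limit. -/
theorem eventually_wHat_mem_Icc (hp : 2 ≤ p) (hN : Tendsto N l atTop)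
    {X : ∀ z : ι, Matrix (Fin (N z)) (Fin q) ℝ} {Y : ∀ z : ι, Matrix (Fin (N z)) (Fin p) ℝ}
    {Sig : Matrix (Fin p) (Fin p) ℝ} (hSig : Sig.PosDef) {γ : EuclideanSpace ℝ (Fin p)}
    (hγ : ‖γ‖ = 1) {δ : ℝ} (hδ : 0 < δ)
    (hSE : Tendsto (fun z => (N z : ℝ)⁻¹ • SE (X z) (Y z)) l (𝓝 Sig))
    (hSR : Tendsto (fun z => (N z : ℝ)⁻¹ • SR (X z) (Y z)) l
      (𝓝 (δ • vecMulVec γ.ofLp γ.ofLp))) :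
    ∀ᶠ z in l, wHat hp (X z) (Y z) ∈ Set.Icc (0 : ℝ) 1 := by
  have hγγ := dotProduct_self_eq_one hγ
  have hγ0 : γ.ofLp ≠ 0 := by
    intro h
    rw [h, zero_dotProduct] at hγγ
    exact zero_ne_one hγγ
  have hsig := tendsto_sigmaHat hN hSE
  have htr : Tendsto (fun z => (sigmaHat (X z) (Y z)).trace) l (𝓝 Sig.trace) :=
    ((continuous_id.matrix_trace).tendsto Sig).comp hsig
  have hquad : Tendsto (fun z => γ.ofLp ⬝ᵥ sigmaHat (X z) (Y z) *ᵥ γ.ofLp) l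
      (𝓝 (γ.ofLp ⬝ᵥ Sig *ᵥ γ.ofLp)) :=
    ((continuous_const.dotProduct (continuous_id.matrix_mulVec continuous_const)).tendsto
      Sig).comp hsig
  have hquad0 : 0 < γ.ofLp ⬝ᵥ Sig *ᵥ γ.ofLp := by simpa using hSig.dotProduct_mulVec_pos hγ0
  have hc : Tendsto (fun z => (N z : ℝ)⁻¹ * cHat (X z) (Y z)) l (𝓝 δ) := by
    have h1 : Tendsto (fun z => ((N z : ℝ)⁻¹ • SR (X z) (Y z)).trace) l
        (𝓝 (δ • vecMulVec γ.ofLp γ.ofLp).trace) :=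
      ((continuous_id.matrix_trace).tendsto _).comp hSR
    have h2 := ((tendsto_inv_atTop_nhds_zero_nat (𝕜 := ℝ)).comp hN).mul (htr.const_mul (q : ℝ))
    have h3 := h1.sub h2
    rw [trace_smul, trace_vecMulVec, hγγ, smul_eq_mul, mul_one, zero_mul, sub_zero] at h3
    refine h3.congr fun z => ?_
    rw [cHat, trace_smul, smul_eq_mul, mul_sub, Function.comp_apply]
  have htr0 : 0 ≤ Sig.trace := hSig.posSemidef.trace_nonneg
  have hb := (hquad.add htr).eventually_const_lt (add_pos_of_pos_of_nonneg hquad0 htr0)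
  filter_upwards [hN.eventually_ge_atTop (q + 3), hb, hc.eventually_const_lt hδ] with z hn hbz hcz
  refine wHat_mem_Icc hp (aHat_nonneg hn _ _) ?_ ?_
  · have := dotProduct_mulVec_le_eig1 hp (sigmaHat_isHermitian (X z) (Y z)) γ.ofLp
    rw [hγγ, mul_one] at this
    rw [bHat]
    linarith
  · exact (pos_of_mul_pos_right hcz (by positivity)).le

end Limits

/-! ### Consistency -/

section Consistency

variable {p q : ℕ} {ι : Type*} {l : Filter ι} {N : ι → ℕ}

/-- Consistency of the feasible estimate along any filter along which the scaled sums of squares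
converge to a positive multiple of `γ γ'` and to `Sig`. -/
theorem tendsto_signError (hp : 2 ≤ p) (hN : Tendsto N l atTop)
    {X : ∀ z : ι, Matrix (Fin (N z)) (Fin q) ℝ} {Y : ∀ z : ι, Matrix (Fin (N z)) (Fin p) ℝ}
    {Sig : Matrix (Fin p) (Fin p) ℝ} (hSig : Sig.PosDef)
    (hgap : eig2 hp hSig.isHermitian < eig1 hp hSig.isHermitian)
    {γ : EuclideanSpace ℝ (Fin p)} (hγ : IsFirstPrincipalEigenvector hp hSig.isHermitian γ)
    {δ : ℝ} (hδ : 0 < δ)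
    (hSE : Tendsto (fun z => (N z : ℝ)⁻¹ • SE (X z) (Y z)) l (𝓝 Sig))
    (hSR : Tendsto (fun z => (N z : ℝ)⁻¹ • SR (X z) (Y z)) l
      (𝓝 (δ • vecMulVec γ.ofLp γ.ofLp)))
    {g : ι → EuclideanSpace ℝ (Fin p)} (hg : ∀ z, IsFeasibleEstimate hp (X z) (Y z) (g z)) :
    Tendsto (fun z => signError (g z) γ) l (𝓝 0) := by
  set κ := min δ (eig1 hp hSig.isHermitian - eig2 hp hSig.isHermitian) with hκ_def
  have hκ : 0 < κ := lt_min hδ (sub_pos.2 hgap)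
  let B : ι → ℝ := fun z => 2 / κ * (2 *
    (entrySum ((N z : ℝ)⁻¹ • SR (X z) (Y z) - δ • vecMulVec γ.ofLp γ.ofLp) +
      entrySum ((N z : ℝ)⁻¹ • SE (X z) (Y z) - Sig)))
  have hB : Tendsto B l (𝓝 0) := by
    simpa using (((entrySum_tendsto_zero hSR).add (entrySum_tendsto_zero hSE)).const_mul
      2).const_mul (2 / κ)
  have hle : ∀ᶠ z in l, signError (g z) γ ≤ √(B z) := by
    filter_upwards [eventually_wHat_mem_Icc hp hN hSig hγ.1 hδ hSE hSR] with z hw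
    have hmax : γ.ofLp ⬝ᵥ S (wHat hp (X z) (Y z)) (X z) (Y z) *ᵥ γ.ofLp ≤
        (g z).ofLp ⬝ᵥ S (wHat hp (X z) (Y z)) (X z) (Y z) *ᵥ (g z).ofLp := by
      rw [(hg z).dotProduct_mulVec_self]
      have := dotProduct_mulVec_le_eig1 hp
        (S_isHermitian (wHat hp (X z) (Y z)) (X z) (Y z)) γ.ofLp
      rwa [dotProduct_self_eq_one hγ.1, mul_one] at this
    have hscale : (1 - wHat hp (X z) (Y z)) • (N z : ℝ)⁻¹ • SR (X z) (Y z) +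
        wHat hp (X z) (Y z) • (N z : ℝ)⁻¹ • SE (X z) (Y z) =
        (N z : ℝ)⁻¹ • S (wHat hp (X z) (Y z)) (X z) (Y z) := by
      rw [S, smul_add, smul_comm (N z : ℝ)⁻¹, smul_comm (N z : ℝ)⁻¹]
    have h1 := gap_mul_le_of_convexCombination hγ hgap (δ := δ) hw.1 hw.2 (hg z).1
      (A := (N z : ℝ)⁻¹ • SR (X z) (Y z)) (B := (N z : ℝ)⁻¹ • SE (X z) (Y z)) (by
        rw [hscale, smul_mulVec, smul_mulVec, dotProduct_smul, dotProduct_smul]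
        exact smul_le_smul_of_nonneg_left hmax (by positivity))
    have h2 := signError_sq_le (hg z).1 hγ.1
    refine Real.le_sqrt_of_sq_le (h2.trans ?_)
    rw [← hκ_def] at h1
    simp only [B]
    rw [div_mul_eq_mul_div, le_div_iff₀ hκ]
    linarith
  have hsqrt : Tendsto (fun z => √(B z)) l (𝓝 0) := by simpa using hB.sqrt
  exact squeeze_zero' (Eventually.of_forall fun z => le_min (norm_nonneg _) (norm_nonneg _)) hle
    hsqrt

end Consistency

end AllometricRegression

theorem mainTheorem8 {p q : ℕ} (hp : 2 ≤ p)
    -- fixed parameters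
    (μ : Fin p → ℝ) (α : Fin q → ℝ) (hα : α ≠ 0)
    (Sig : Matrix (Fin p) (Fin p) ℝ) (hSig : Sig.PosDef)
    (hgap : AllometricRegression.eig2 hp hSig.isHermitian <
      AllometricRegression.eig1 hp hSig.isHermitian)
    (γ₁ : EuclideanSpace ℝ (Fin p))
    (hγ₁ : AllometricRegression.IsFirstPrincipalEigenvector hp hSig.isHermitian γ₁)
    -- centred explanatory variables with convergent second moments
    (X : ∀ n : ℕ, Matrix (Fin n) (Fin q) ℝ)
    (hX : ∀ n, (X n)ᵀ *ᵥ (fun _ => (1 : ℝ)) = 0)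
    (M : Matrix (Fin q) (Fin q) ℝ) (hM : M.PosDef)
    (hXM : Tendsto (fun n : ℕ => (n : ℝ)⁻¹ • ((X n)ᵀ * X n)) atTop (𝓝 M))
    -- normal errors
    {Ω : ℕ → Type*} [∀ n, MeasurableSpace (Ω n)] (P : ∀ n, Measure (Ω n))
    [∀ n, IsProbabilityMeasure (P n)]
    (E : ∀ n : ℕ, Ω n → Matrix (Fin n) (Fin p) ℝ)
    (hE : ∀ n, AllometricRegression.IsNormalError Sig (E n) (P n))
    -- any version of the feasible estimator
    (γhat : ∀ n : ℕ, Ω n → EuclideanSpace ℝ (Fin p))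
    (hγhat : ∀ n ω, AllometricRegression.IsFeasibleEstimate hp (X n)
      (AllometricRegression.response μ α γ₁ (X n) (E n ω)) (γhat n ω)) :
    AllometricRegression.TendstoZeroInProbability P
      (fun n ω => AllometricRegression.signError (γhat n ω) γ₁) := by
  open AllometricRegression in
  have hN := tendsto_fst_highProbability (P := P)
  have hXM' := hXM.comp hN
  have hXE : Tendsto (fun z : Σ n, Ω n => (z.1 : ℝ)⁻¹ • ((X z.1)ᵀ * E z.1 z.2))
      (highProbability P) (𝓝 0) := by
    refine tendsto_pi_nhds.2 fun k => tendsto_pi_nhds.2 fun a => ?_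
    have h := ((continuous_apply_apply k k).tendsto M).comp hXM
    exact tendsto_weighted_mean_error hSig.posSemidef hE (fun n i => X n i k) h a
  have h1E : Tendsto (fun z : Σ n, Ω n => (z.1 : ℝ)⁻¹ • (E z.1 z.2)ᵀ *ᵥ (fun _ => (1 : ℝ)))
      (highProbability P) (𝓝 0) := by
    refine tendsto_pi_nhds.2 fun a => ?_
    have h : Tendsto (fun n : ℕ => (n : ℝ)⁻¹ * ∑ _i : Fin n, (1 : ℝ) * 1) atTop (𝓝 1) := by
      refine tendsto_const_nhds.congr' ?_
      filter_upwards [eventually_ne_atTop 0] with n hn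
      simp [hn]
    have := tendsto_weighted_mean_error hSig.posSemidef hE (fun _ _ => 1) h a
    simpa [mulVec, dotProduct] using this
  have hEE : Tendsto (fun z : Σ n, Ω n => (z.1 : ℝ)⁻¹ • ((E z.1 z.2)ᵀ * E z.1 z.2))
      (highProbability P) (𝓝 Sig) :=
    tendsto_pi_nhds.2 fun a => tendsto_pi_nhds.2 fun b =>
      tendsto_second_moment_error hSig.posSemidef hE a b
  have hδ : 0 < α ⬝ᵥ M *ᵥ α := by simpa using hM.dotProduct_mulVec_pos hα
  exact tendstoZeroInProbability_of_tendsto <| tendsto_signError hp hN hSig hgap hγ₁ hδ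
    (tendsto_inv_smul_SE_response hN (fun z => hX z.1) hM hXM' hXE h1E hEE μ α γ₁)
    (tendsto_inv_smul_SR_response hN (fun z => hX z.1) hM hXM' hXE μ α γ₁)
    (fun z => hγhat z.1 z.2)
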